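/- Let $m\ge 2$ be a fixed number of candidates. A profile of $n$ voters is a vector $(n_r)_r$ of nonnegative integers with sum $n$, indexed by the $m!$ rankings $r$ of the candidates, where $n_r$ is the number of voters with ranking $r$. For a set $S$ of candidates and $c\in S$, let $n_{c\succeq S}$ (the plurality score of $c$ in $S$) be the number of voters who rank $c$ above all other candidates in $S$. A candidate $c$ is a Super Condorcet Winner if $n_{c\succeq S}>n/|S|$ for every set $S$ of candidates with $c\in S$ and $|S|\ge 2$. Instant-Runoff Voting (IRV) starts from the set of all candidates and repeatedly eliminates from the current set $S$ a candidate whose plurality score in $S$ is minimal, ties being broken by an arbitrary predetermined rule, until a single candidate, the winner, remains. A voting rule $f$ is coalitionally manipulable in a profile $(n_r)_r$ if there is a profile $(n'_r)_r\neq(n_r)_r$ of the same number $n$ of voters such that every ranking $r$ with $n'_r<n_r$ places $f((n'_r)_r)$ strictly above $f((n_r)_r)$; otherwise $f$ is immune to coalitional manipulation in that profile. Under Impartial Culture, the $n$ voters draw their rankings independently and uniformly at random among the $m!$ rankings. Theorem. For every $m\ge 2$ and all tie-breaking rules (which may depend on the profile and on $n$), under Impartial Culture with $n$ voters and $m$ candidates,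 $$\mathbb{P}_{n,m}\bigl(\text{IRV is immune to coalitional manipulation} \iff \text{a Super Condorcet Winner exists}\bigr)\longrightarrow 1\qquad\text{as } n\to\infty .$$ -/

import Mathlib

open Filter Topology MeasureTheory

namespace Voting

/-- A ranking of the candidates `Fin m`: `r c` is the position of candidate `c`,
position `0` being the top. -/
abbrev Ranking (m : ℕ) : Type := Equiv.Perm (Fin m)

/-- Ranking `r` places `a` above `b`. -/
abbrev Ranking.Prefers {m : ℕ} (r : Ranking m) (a b : Fin m) : Prop := r a < r b

/-- A profile of `n` voters over `m` candidates: the number of voters with each ranking. -/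
abbrev Profile (m n : ℕ) : Type := {p : Ranking m → ℕ // ∑ r, p r = n}

/-- A voting rule maps each profile to a candidate. -/
abbrev VotingRule (m n : ℕ) : Type := Profile m n → Fin m

/-- Plurality score of `c` in `S`: the number of voters who rank `c` above every other
candidate of `S`. -/
def score {m n : ℕ} (p : Profile m n) (S : Finset (Fin m)) (c : Fin m) : ℕ :=
  ∑ r : Ranking m with ∀ d ∈ S, d ≠ c → r.Prefers c d, p.1 r

/-- `c` is a Super Condorcet Winner: in every set of at least two candidates that contains `c`,
its plurality score exceeds the average. -/
def IsSuperCondorcetWinner {m n : ℕ} (p : Profile m n) (c : Fin m) : Prop :=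
  ∀ S : Finset (Fin m), c ∈ S → 2 ≤ S.card → (n : ℝ) / (S.card : ℝ) < (score p S c : ℝ)

/-- `f` is coalitionally manipulable in `p`: there is a different target profile of the same
voters in which only voters who strictly prefer the new outcome have left their ranking. -/
def IsManipulable {m n : ℕ} (f : VotingRule m n) (p : Profile m n) : Prop :=
  ∃ p' : Profile m n, p' ≠ p ∧ ∀ r : Ranking m, p'.1 r < p.1 r → r.Prefers (f p') (f p)

/-- An arbitrary deterministic tie-breaking rule: it picks one of the tied candidates, possibly
depending on the whole profile. (In one run of the elimination process the set of tied candidates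
never occurs twice, so that dependence on the round is covered as well.) -/
structure TieBreakingRule (m n : ℕ) where
  pick : Profile m n → Finset (Fin m) → Fin m
  pick_mem : ∀ (p : Profile m n) (T : Finset (Fin m)), T.Nonempty → pick p T ∈ T

/-- The candidates of `S` whose plurality score in `S` is minimal. -/
def lowest {m n : ℕ} (p : Profile m n) (S : Finset (Fin m)) : Finset (Fin m) :=
  {c ∈ S | ∀ d ∈ S, score p S c ≤ score p S d}

/-- The set of candidates remaining after `j` rounds of elimination. -/
def remaining {m n : ℕ} (τ : TieBreakingRule m n) (p : Profile m n) : ℕ → Finset (Fin m)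
  | 0 => Finset.univ
  | j + 1 => (remaining τ p j).erase (τ.pick p (lowest p (remaining τ p j)))

theorem pick_lowest_mem {m n : ℕ} (τ : TieBreakingRule m n) (p : Profile m n)
    {S : Finset (Fin m)} (hS : S.Nonempty) : τ.pick p (lowest p S) ∈ lowest p S := by
  apply τ.pick_mem
  obtain ⟨c, hc, hmin⟩ := S.exists_min_image (score p S) hS
  exact ⟨c, by simpa [lowest] using ⟨hc, hmin⟩⟩

theorem card_remaining {m n : ℕ} (τ : TieBreakingRule m n) (p : Profile m n) (j : ℕ)
    (hj : j ≤ m) : (remaining τ p j).card = m - j := by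
  induction j with
  | zero => simp [remaining]
  | succ j ih =>
    have h := ih (by omega)
    have hne : (remaining τ p j).Nonempty := by
      rw [← Finset.card_pos]; omega
    have hmem := (Finset.mem_filter.mp (pick_lowest_mem τ p hne)).1
    rw [remaining, Finset.card_erase_of_mem hmem, h]
    omega

theorem exists_remaining_eq_singleton {m n : ℕ} (hm : 2 ≤ m) (τ : TieBreakingRule m n)
    (p : Profile m n) : ∃ c, remaining τ p (m - 1) = {c} := by
  rw [← Finset.card_eq_one, card_remaining τ p _ (by omega)]
  omega

/-- Instant-Runoff Voting with tie-breaking rule `τ`: the winner is the only candidate left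
after `m - 1` eliminations. -/
noncomputable def irv {m n : ℕ} (hm : 2 ≤ m) (τ : TieBreakingRule m n) : VotingRule m n :=
  fun p => (exists_remaining_eq_singleton hm τ p).choose

/-- The profile that counts, for each ranking, the voters with this ranking. -/
def profileOf {m n : ℕ} (x : Fin n → Ranking m) : Profile m n :=
  ⟨fun r => (Finset.univ.filter fun v => x v = r).card, by
    rw [← Finset.card_eq_sum_card_fiberwise (fun _ _ => Finset.mem_coe.mpr (Finset.mem_univ _)),
      Finset.card_univ, Fintype.card_fin]⟩

instance instMeasurableSpaceRanking (m : ℕ) : MeasurableSpace (Ranking m) := ⊤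

/-- Impartial Culture: `n` rankings drawn independently and uniformly at random. -/
noncomputable def impartialCulture (m n : ℕ) : Measure (Fin n → Ranking m) :=
  Measure.pi fun _ => (PMF.uniformOfFintype (Ranking m)).toMeasure

end Voting

/-! A Super Condorcet Winner `c` is safe in every profile. Voters who gain from electing `d` prefer
`d` to `c`, so while both remain no ballot lost by the profile counted for `c`. Its score stays
above average and `c` cannot leave before `d` (`IsSuperCondorcetWinner.not_isManipulable`).

Conversely, let the IRV winner `w` have score `q ≤ n/|S|` in some `S`. By the central limit theorem
`q = ⌊n/|S|⌋` has vanishing probability (`tendsto_score_eq`), so `|S|(q+1) ≤ n`. This is exactly the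
room needed to give `q+1` votes in `S` to every candidate other than `w` and a favourite `d`, and
`q+2` to `d`, so that `w` leaves `S` first. By the law of large numbers (`tendsto_not_isTypical`)
all blocs have nearly their expected size. Candidates outside `S` then keep only about half a fair
share, from sincere voters, and leave earlier. Finally `d`, chosen to inherit most from `w` and
ranked just below the top of the other coalition ballots, outlasts the rest of `S`
(`exists_successful_coalition`). -/

namespace Voting

/-! ### Counting and constructing rankings -/

/-- The rankings that place `c` above every other candidate of `T`. -/
def topRankings {m : ℕ} (T : Finset (Fin m)) (c : Fin m) : Finset (Ranking m) :=
  {r | ∀ d ∈ T, d ≠ c → r.Prefers c d}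

/-- The number of voters whose ranking lies in `A`. -/
def votes {m n : ℕ} (p : Profile m n) (A : Finset (Ranking m)) : ℕ := ∑ r ∈ A, p.1 r

variable {m n : ℕ}

theorem mem_topRankings {T : Finset (Fin m)} {c : Fin m} {r : Ranking m} :
    r ∈ topRankings T c ↔ ∀ d ∈ T, d ≠ c → r c < r d := by
  simp [topRankings]

theorem score_eq_votes (p : Profile m n) (T : Finset (Fin m)) (c : Fin m) :
    score p T c = votes p (topRankings T c) := rfl

theorem exists_mem_topRankings {T : Finset (Fin m)} (hT : T.Nonempty) (r : Ranking m) :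
    ∃ c ∈ T, r ∈ topRankings T c := by
  obtain ⟨c, hc, hmin⟩ := T.exists_min_image r hT
  exact ⟨c, hc, mem_topRankings.2 fun d hd hdc =>
    lt_of_le_of_ne (hmin d hd) fun h => hdc (r.injective h).symm⟩

theorem eq_of_mem_topRankings {T : Finset (Fin m)} {c d : Fin m} {r : Ranking m} (hc : c ∈ T)
    (hd : d ∈ T) (h1 : r ∈ topRankings T c) (h2 : r ∈ topRankings T d) : c = d := by
  by_contra hne
  exact lt_asymm (mem_topRankings.1 h1 d hd (Ne.symm hne)) (mem_topRankings.1 h2 c hc hne)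

theorem sum_topRankings {T : Finset (Fin m)} (hT : T.Nonempty) (A : Finset (Ranking m))
    (f : Ranking m → ℕ) :
    ∑ c ∈ T, ∑ r ∈ A with r ∈ topRankings T c, f r = ∑ r ∈ A, f r := by
  simp_rw [Finset.sum_filter]
  rw [Finset.sum_comm]
  refine Finset.sum_congr rfl fun r _ => ?_
  obtain ⟨c, hc, hr⟩ := exists_mem_topRankings hT r
  rw [Finset.sum_eq_single_of_mem c hc, if_pos hr]
  intro d hd hdc
  exact if_neg fun h => hdc (eq_of_mem_topRankings hd hc h hr)

theorem sum_score {T : Finset (Fin m)} (hT : T.Nonempty) (p : Profile m n) :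
    ∑ c ∈ T, score p T c = n := by
  have := sum_topRankings hT Finset.univ p.1
  rw [p.2] at this
  simpa [score_eq_votes, votes] using this

/-- Renaming candidates inside `T` is the symmetry behind all the counts below. -/
theorem mul_swap_mem_topRankings {T : Finset (Fin m)} {a b c : Fin m} {r : Ranking m}
    (ha : a ∈ T) (hb : b ∈ T) :
    r * Equiv.swap a b ∈ topRankings T (Equiv.swap a b c) ↔ r ∈ topRankings T c := by
  have hT : ∀ x, x ∈ T → Equiv.swap a b x ∈ T := by
    intro x hx
    rw [Equiv.swap_apply_def]
    split_ifs <;> assumption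
  simp only [mem_topRankings, Equiv.Perm.coe_mul, Function.comp_apply, Equiv.swap_apply_self]
  constructor
  · intro h d hd hdc
    simpa using h (Equiv.swap a b d) (hT d hd) (by simpa using hdc)
  · intro h d hd hdc
    exact h _ (hT d hd) fun h' => hdc (by rw [← h', Equiv.swap_apply_self])

theorem card_mul_card_topRankings {T : Finset (Fin m)} {c : Fin m} (hc : c ∈ T) :
    T.card * (topRankings T c).card = m.factorial := by
  have key : ∀ d ∈ T, (topRankings T d).card = (topRankings T c).card := by
    intro d hd
    refine Finset.card_equiv (Equiv.mulRight (Equiv.swap d c)) fun r => ?_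
    have := mul_swap_mem_topRankings (c := d) (r := r) hd hc
    rw [Equiv.swap_apply_left] at this
    exact this.symm
  have h := sum_topRankings ⟨c, hc⟩ Finset.univ (fun _ : Ranking m => 1)
  simp only [Finset.sum_const, smul_eq_mul, mul_one, Finset.filter_univ_mem, Finset.card_univ,
    Fintype.card_perm, Fintype.card_fin] at h
  rw [← h, Finset.sum_congr rfl key, Finset.sum_const, smul_eq_mul]

theorem two_mul_card_mul_card_topRankings_prefers {T : Finset (Fin m)} {c w d : Fin m}
    (hc : c ∈ T) (hw : w ∈ T) (hd : d ∈ T) (hwd : w ≠ d) (hcw : c ≠ w) (hcd : c ≠ d) :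
    2 * T.card * {r ∈ topRankings T c | r w < r d}.card = m.factorial := by
  have h1 : {r ∈ topRankings T c | r w < r d}.card
      = {r ∈ topRankings T c | ¬ r w < r d}.card := by
    refine Finset.card_equiv (Equiv.mulRight (Equiv.swap w d)) fun r => ?_
    have := mul_swap_mem_topRankings (c := c) (r := r) hw hd
    rw [Equiv.swap_apply_of_ne_of_ne hcw hcd] at this
    have hne : r w ≠ r d := fun h => hwd (r.injective h)
    simp only [Finset.mem_filter, Equiv.coe_mulRight, this, Equiv.Perm.coe_mul,
      Function.comp_apply, Equiv.swap_apply_left, Equiv.swap_apply_right, not_lt]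
    rw [le_iff_lt_or_eq, or_iff_left hne]
  have h2 := Finset.card_filter_add_card_filter_not (s := topRankings T c) (fun r => r w < r d)
  have h3 := card_mul_card_topRankings hc
  rw [← h2, ← h1] at h3
  rw [← h3]
  ring

theorem topRankings_filter_prefers_eq {T : Finset (Fin m)} {w d : Fin m} (hd : d ∈ T)
    (hw : w ∉ T) :
    {r ∈ topRankings T d | r w < r d} =
      {r ∈ topRankings (insert w T) w | r ∈ topRankings T d} := by
  ext r
  simp only [Finset.mem_filter, mem_topRankings, Finset.mem_insert]
  constructor
  · rintro ⟨h, hwd⟩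
    refine ⟨?_, h⟩
    rintro x (rfl | hx) hne
    · exact absurd rfl hne
    · by_cases hxd : x = d
      · rwa [hxd]
      · exact hwd.trans (h x hx hxd)
  · rintro ⟨h1, h2⟩
    exact ⟨h2, h1 d (Or.inr hd) fun h => hw (h ▸ hd)⟩

/-- These rankings put `w` first and `d` second within `insert w T`; by symmetry all ordered pairs
are equally frequent there. -/
theorem card_mul_succ_mul_card_topRankings_prefers {T : Finset (Fin m)} {w d : Fin m}
    (hd : d ∈ T) (hw : w ∉ T) :
    T.card * (T.card + 1) * {r ∈ topRankings T d | r w < r d}.card = m.factorial := by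
  rw [topRankings_filter_prefers_eq hd hw]
  have key : ∀ c ∈ T, {r ∈ topRankings (insert w T) w | r ∈ topRankings T c}.card
      = {r ∈ topRankings (insert w T) w | r ∈ topRankings T d}.card := by
    intro c hc
    refine Finset.card_equiv (Equiv.mulRight (Equiv.swap c d)) fun r => ?_
    have h1 := mul_swap_mem_topRankings (c := c) (r := r) hc hd
    have h2 := mul_swap_mem_topRankings (c := w) (r := r)
      (Finset.mem_insert_of_mem (a := c) (b := w) hc) (Finset.mem_insert_of_mem hd)
    rw [Equiv.swap_apply_left] at h1
    rw [Equiv.swap_apply_of_ne_of_ne (fun h : w = c => hw (h ▸ hc))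
      (fun h : w = d => hw (h ▸ hd))] at h2
    simp only [Finset.mem_filter, Equiv.coe_mulRight, h1, h2]
  have h := sum_topRankings ⟨d, hd⟩ (topRankings (insert w T) w) (fun _ : Ranking m => 1)
  simp only [Finset.sum_const, smul_eq_mul, mul_one] at h
  rw [Finset.sum_congr rfl key, Finset.sum_const, smul_eq_mul] at h
  have h3 := card_mul_card_topRankings (Finset.mem_insert_self w T)
  rw [← h3, ← h, Finset.card_insert_of_notMem hw]
  ring

/-- A ranking with `j` on top, and with `d` in the highest place that this leaves. -/
theorem exists_ranking_top_second (hm : 2 ≤ m) (j d : Fin m) :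
    ∃ r : Ranking m, (∀ c, c ≠ j → r j < r c) ∧ ∀ c, c ≠ j → c ≠ d → r d < r c := by
  obtain ⟨k, rfl⟩ : ∃ k, m = k + 2 := ⟨m - 2, by omega⟩
  by_cases hjd : j = d
  · subst hjd
    have h : ∀ c, c ≠ j → Equiv.swap j 0 j < Equiv.swap j 0 c := by
      intro c hc
      rw [Equiv.swap_apply_left, Fin.pos_iff_ne_zero]
      intro h
      exact hc (by rw [← Equiv.swap_apply_self j 0 c, h, Equiv.swap_apply_right])
    exact ⟨Equiv.swap j 0, h, fun c hc _ => h c hc⟩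
  -- The first swap brings `j` to place 0 and `d` to place `e`; the second then brings `d` to place
  -- 1.
  · set e : Fin (k + 2) := Equiv.swap j 0 d
    have he : e ≠ 0 := by
      intro h
      have : d = j := by rw [← Equiv.swap_apply_self j 0 d]; simp [e] at h; simp [h]
      exact hjd this.symm
    have hj : (Equiv.swap e 1 * Equiv.swap j 0) j = 0 := by
      rw [Equiv.Perm.mul_apply, Equiv.swap_apply_left,
        Equiv.swap_apply_of_ne_of_ne he.symm (by simp)]
    have hd : (Equiv.swap e 1 * Equiv.swap j 0) d = 1 := by
      rw [Equiv.Perm.mul_apply]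
      exact Equiv.swap_apply_left e 1
    refine ⟨Equiv.swap e 1 * Equiv.swap j 0, ?_, ?_⟩
    · intro c hc
      rw [hj, Fin.pos_iff_ne_zero]
      intro h
      exact hc ((Equiv.swap e 1 * Equiv.swap j 0).injective (h.trans hj.symm))
    · intro c hc hcd
      have h0 : (Equiv.swap e 1 * Equiv.swap j 0) c ≠ 0 := fun h =>
        hc ((Equiv.swap e 1 * Equiv.swap j 0).injective (h.trans hj.symm))
      have h1 : (Equiv.swap e 1 * Equiv.swap j 0) c ≠ 1 := fun h =>
        hcd ((Equiv.swap e 1 * Equiv.swap j 0).injective (h.trans hd.symm))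
      rw [hd]
      generalize (Equiv.swap e 1 * Equiv.swap j 0) c = x at h0 h1
      have h0' : (x : ℕ) ≠ 0 := fun h => h0 (Fin.ext h)
      have h1' : (x : ℕ) ≠ 1 := fun h => h1 (Fin.ext h)
      rw [Fin.lt_def, Fin.val_one]
      omega

/-! ### The course of the elimination -/

theorem remaining_eq_singleton_irv (hm : 2 ≤ m) (τ : TieBreakingRule m n) (p : Profile m n) :
    remaining τ p (m - 1) = {irv hm τ p} :=
  (exists_remaining_eq_singleton hm τ p).choose_spec

theorem remaining_antitone (τ : TieBreakingRule m n) (p : Profile m n) :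
    Antitone (remaining τ p) :=
  antitone_nat_of_succ_le fun _ => Finset.erase_subset _ _

theorem two_le_card_remaining (τ : TieBreakingRule m n) (p : Profile m n) {j : ℕ}
    (hj : j + 1 ≤ m - 1) : 2 ≤ (remaining τ p j).card := by
  rw [card_remaining τ p j (by omega)]
  omega

theorem pick_mem_lowest_remaining (τ : TieBreakingRule m n) (p : Profile m n) {j : ℕ}
    (hj : j + 1 ≤ m - 1) :
    τ.pick p (lowest p (remaining τ p j)) ∈ lowest p (remaining τ p j) := by
  apply pick_lowest_mem
  rw [← Finset.card_pos]
  have := two_le_card_remaining τ p hj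
  omega

theorem card_mul_score_le_of_mem_lowest {p : Profile m n} {T : Finset (Fin m)} {c : Fin m}
    (hc : c ∈ lowest p T) : T.card * score p T c ≤ n := by
  obtain ⟨hcT, hmin⟩ := Finset.mem_filter.1 hc
  calc T.card * score p T c = ∑ _d ∈ T, score p T c := by simp
    _ ≤ ∑ d ∈ T, score p T d := Finset.sum_le_sum hmin
    _ = n := sum_score ⟨c, hcT⟩ p

/-- A candidate that is never among the lowest as long as the eventual winner remains wins. -/
theorem irv_eq_of_notMem_lowest (hm : 2 ≤ m) (τ : TieBreakingRule m n) (p : Profile m n)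
    (c : Fin m)
    (h : ∀ T, c ∈ T → irv hm τ p ∈ T → 2 ≤ T.card → c ∉ lowest p T) : irv hm τ p = c := by
  have hirv : ∀ j ≤ m - 1, irv hm τ p ∈ remaining τ p j := by
    intro j hj
    apply remaining_antitone τ p hj
    rw [remaining_eq_singleton_irv hm]
    exact Finset.mem_singleton_self _
  have key : ∀ j ≤ m - 1, c ∈ remaining τ p j := by
    intro j
    induction j with
    | zero => intro _; simp [remaining]
    | succ j ih =>
      intro hj
      have hc := ih (by omega)
      refine Finset.mem_erase.2 ⟨?_, hc⟩
      intro hpick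
      apply h _ hc (hirv j (by omega)) (two_le_card_remaining τ p hj)
      rw [hpick]
      exact pick_mem_lowest_remaining τ p hj
  have := key _ le_rfl
  rw [remaining_eq_singleton_irv hm] at this
  exact (Finset.mem_singleton.1 this).symm

/-! ### Immunity under a Super Condorcet Winner -/

theorem IsSuperCondorcetWinner.lt_card_mul_score {p : Profile m n} {c : Fin m}
    (hc : IsSuperCondorcetWinner p c) {T : Finset (Fin m)} (hcT : c ∈ T) (hT : 2 ≤ T.card) :
    n < T.card * score p T c := by
  have h := hc T hcT hT
  rw [div_lt_iff₀ (by exact_mod_cast (by omega : 0 < T.card)), mul_comm] at h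
  exact_mod_cast h

theorem IsSuperCondorcetWinner.irv_eq {p : Profile m n} {c : Fin m}
    (hc : IsSuperCondorcetWinner p c) (hm : 2 ≤ m) (τ : TieBreakingRule m n) :
    irv hm τ p = c :=
  irv_eq_of_notMem_lowest hm τ p c fun _ hcT _ hT hlow =>
    (hc.lt_card_mul_score hcT hT).not_ge (card_mul_score_le_of_mem_lowest hlow)

theorem IsSuperCondorcetWinner.not_isManipulable {p : Profile m n} {c : Fin m}
    (hc : IsSuperCondorcetWinner p c) (hm : 2 ≤ m) (τ : TieBreakingRule m n) :
    ¬ IsManipulable (irv hm τ) p := by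
  rintro ⟨p', hne, h⟩
  rw [hc.irv_eq hm τ] at h
  -- If `c` still won, nobody could have left their ranking, and equal totals would force `p' = p`.
  have hwin : irv hm τ p' ≠ c := by
    intro hd
    have hle : ∀ r ∈ Finset.univ, p.1 r ≤ p'.1 r := by
      intro r _
      by_contra hlt
      have := h r (not_le.1 hlt)
      rw [hd] at this
      exact lt_irrefl _ this
    have hsum := (Finset.sum_eq_sum_iff_of_le hle).1 (p.2.trans p'.2.symm)
    exact hne (Subtype.ext (funext fun r => (hsum r (Finset.mem_univ r)).symm))
  refine hwin (irv_eq_of_notMem_lowest hm τ p' c fun T hcT hdT hT hlow => ?_)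
  have hle : score p T c ≤ score p' T c := by
    refine Finset.sum_le_sum fun r hr => ?_
    by_contra hlt
    exact lt_asymm (h r (not_le.1 hlt)) ((Finset.mem_filter.1 hr).2 _ hdT hwin)
  exact (hc.lt_card_mul_score hcT hT).not_ge
    ((Nat.mul_le_mul_left _ hle).trans (card_mul_score_le_of_mem_lowest hlow))

/-! ### The target profile of a coalition -/

/-- If the candidates outside `S` leave first, then `w`, and if `d` survives afterwards, then `d`
wins. -/
theorem irv_eq_of_lowest (hm : 2 ≤ m) (τ : TieBreakingRule m n) (p : Profile m n)
    {S : Finset (Fin m)} {w d : Fin m} (hw : w ∈ S) (hd : d ∈ S) (hwd : w ≠ d)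
    (h1 : ∀ T, S ⊂ T → ∀ c ∈ lowest p T, c ∉ S) (h2 : ∀ c ∈ lowest p S, c = w)
    (h3 : ∀ T ⊆ S.erase w, d ∈ T → 2 ≤ T.card → d ∉ lowest p T) : irv hm τ p = d := by
  have key : ∀ j ≤ m - 1, S ⊆ remaining τ p j ∨
      (remaining τ p j ⊆ S.erase w ∧ d ∈ remaining τ p j) := by
    intro j
    induction j with
    | zero => intro _; left; simp [remaining]
    | succ j ih =>
      intro hj
      have hpick := pick_mem_lowest_remaining τ p hj
      rcases ih (by omega) with hS | ⟨hR, hdR⟩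
      · rcases hS.eq_or_ssubset with heq | hss
        · right
          rw [← heq] at hpick
          have hpw := h2 _ hpick
          rw [remaining, ← heq, hpw]
          exact ⟨subset_rfl, Finset.mem_erase.2 ⟨hwd.symm, hd⟩⟩
        · left
          intro x hx
          refine Finset.mem_erase.2 ⟨?_, hS hx⟩
          rintro rfl
          exact h1 _ hss _ hpick hx
      · right
        refine ⟨(Finset.erase_subset _ _).trans hR, Finset.mem_erase.2 ⟨?_, hdR⟩⟩
        intro hpd
        apply h3 _ hR hdR (two_le_card_remaining τ p hj)
        rw [hpd]
        exact hpick
  have := key _ le_rfl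
  rw [remaining_eq_singleton_irv hm τ p] at this
  rcases this with hS | ⟨_, hdR⟩
  · exact absurd ((Finset.mem_singleton.1 (hS hw)).trans (Finset.mem_singleton.1 (hS hd)).symm) hwd
  · exact (Finset.mem_singleton.1 hdR).symm

/-- The number of voters who place `w` above `d`, and `c` above the other candidates of `T`. -/
def sincereVotes (p : Profile m n) (w d : Fin m) (T : Finset (Fin m)) (c : Fin m) : ℕ :=
  votes p {r ∈ topRankings T c | r w < r d}

/-- Voters who prefer `w` to `d` stay sincere. All others are replaced by `β j` ballots with `j` on
top and `d` next, each of which counts for `j` while `j` remains and for `d` afterwards. -/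
theorem exists_target_profile (hm : 2 ≤ m) (p : Profile m n) (w d : Fin m) (β : Fin m → ℕ)
    (hβ : votes p {r | r w < r d} + ∑ j, β j = n) :
    ∃ p' : Profile m n, (∀ r, p'.1 r < p.1 r → ¬ r w < r d) ∧
      ∀ T, d ∈ T → ∀ c ∈ T, score p' T c =
        sincereVotes p w d T c + ∑ j, if c = (if j ∈ T then j else d) then β j else 0 := by
  choose b hb1 hb2 using fun j => exists_ranking_top_second hm j d
  have htop : ∀ T, d ∈ T → ∀ c ∈ T, ∀ j,
      b j ∈ topRankings T c ↔ c = if j ∈ T then j else d := by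
    intro T hd c hc j
    have hmem : b j ∈ topRankings T (if j ∈ T then j else d) := by
      rw [mem_topRankings]
      split_ifs with hj
      · exact fun x _ hx => hb1 j x hx
      · exact fun x hxT hx => hb2 j x (fun h => hj (h ▸ hxT)) hx
    have hT : (if j ∈ T then j else d) ∈ T := by
      split_ifs <;> assumption
    constructor
    · intro h
      exact eq_of_mem_topRankings hc hT h hmem
    · intro h
      rw [h]
      exact hmem
  refine ⟨⟨fun r => (if r w < r d then p.1 r else 0) + ∑ j, if b j = r then β j else 0, ?_⟩,
    ?_, ?_⟩
  · rw [Finset.sum_add_distrib, Finset.sum_comm, ← Finset.sum_filter]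
    simpa [votes] using hβ
  · intro r hlt hr
    simp only [if_pos hr] at hlt
    omega
  · intro T hd c hc
    rw [score_eq_votes, votes]
    simp only
    rw [Finset.sum_add_distrib, Finset.sum_comm, ← Finset.sum_filter]
    congr 1
    refine Finset.sum_congr rfl fun j _ => ?_
    rw [Finset.sum_ite_eq]
    exact if_congr (htop T hd c hc j) rfl rfl

/-! ### Typical profiles and sincere votes -/

/-- Every set of rankings has its expected share of the voters, up to the fraction `δ` of all
voters. -/
def IsTypical (p : Profile m n) (δ : ℝ) : Prop :=
  ∀ A : Finset (Ranking m), |(votes p A : ℝ) - n * (A.card / m.factorial)| ≤ δ * n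

theorem IsTypical.abs_votes_sub_le {p : Profile m n} {δ : ℝ} (h : IsTypical p δ)
    {A : Finset (Ranking m)} {k : ℕ} (hk : k * A.card = m.factorial) :
    |(votes p A : ℝ) - n / k| ≤ δ * n := by
  have h1 := h A
  have hfac : (0 : ℝ) < m.factorial := by exact_mod_cast m.factorial_pos
  have hk' : (k : ℝ) * A.card = m.factorial := by exact_mod_cast hk
  have hk0 : (k : ℝ) ≠ 0 := by
    rintro h0
    rw [h0, zero_mul] at hk'
    exact hfac.ne hk'
  have hA : (A.card : ℝ) ≠ 0 := by
    rintro h0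
    rw [h0, mul_zero] at hk'
    exact hfac.ne hk'
  have h2 : (A.card : ℝ) / m.factorial = 1 / k := by
    rw [← hk']
    field_simp
  rwa [h2, mul_one_div] at h1

theorem sincereVotes_self (p : Profile m n) {w d : Fin m} {T : Finset (Fin m)} (hd : d ∈ T)
    (hwd : w ≠ d) : sincereVotes p w d T w = score p T w := by
  rw [score_eq_votes, sincereVotes, Finset.filter_true_of_mem]
  intro r hr
  exact mem_topRankings.1 hr d hd hwd.symm

theorem sincereVotes_eq_zero (p : Profile m n) {w d : Fin m} {T : Finset (Fin m)} (hw : w ∈ T)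
    (hwd : w ≠ d) : sincereVotes p w d T d = 0 := by
  rw [sincereVotes, Finset.filter_false_of_mem, votes, Finset.sum_empty]
  intro r hr
  exact lt_asymm (mem_topRankings.1 hr w hw hwd)

theorem sum_sincereVotes (p : Profile m n) (w d : Fin m) {T : Finset (Fin m)}
    (hT : T.Nonempty) : ∑ c ∈ T, sincereVotes p w d T c = votes p {r | r w < r d} := by
  rw [votes, ← sum_topRankings hT]
  refine Finset.sum_congr rfl fun c _ => ?_
  rw [sincereVotes, votes, Finset.filter_filter]
  refine Finset.sum_congr ?_ fun _ _ => rfl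
  ext r
  simp [and_comm]

/-- When `w` leaves, its ballots pass to their next choice in `S`. They are all sincere because `d ∈
S`, so the second term needs no restriction. -/
theorem sincereVotes_erase (p : Profile m n) {w d c : Fin m} {S : Finset (Fin m)} (hw : w ∈ S)
    (hd : d ∈ S) (hc : c ∈ S) (hcw : c ≠ w) (hwd : w ≠ d) :
    sincereVotes p w d (S.erase w) c =
      sincereVotes p w d S c + votes p {r ∈ topRankings S w | r ∈ topRankings (S.erase w) c} := by
  rw [sincereVotes, votes, ← Finset.sum_filter_add_sum_filter_not _ (fun r => r c < r w)]
  congr 1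
  · refine Finset.sum_congr ?_ fun _ _ => rfl
    ext r
    simp only [Finset.mem_filter, mem_topRankings, Finset.mem_erase]
    constructor
    · rintro ⟨⟨h1, h2⟩, h3⟩
      refine ⟨fun x hx hxc => ?_, h2⟩
      by_cases hxw : x = w
      · rwa [hxw]
      · exact h1 x ⟨hxw, hx⟩ hxc
    · rintro ⟨h1, h2⟩
      exact ⟨⟨fun x hx hxc => h1 x hx.2 hxc, h2⟩, h1 w hw hcw.symm⟩
  · refine Finset.sum_congr ?_ fun _ _ => rfl
    ext r
    simp only [Finset.mem_filter, mem_topRankings, Finset.mem_erase, not_lt]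
    constructor
    · rintro ⟨⟨h1, h2⟩, h3⟩
      refine ⟨fun x hx hxw => ?_, h1⟩
      have hwc : r w < r c := lt_of_le_of_ne h3 fun h => hcw (r.injective h).symm
      by_cases hxc : x = c
      · rwa [hxc]
      · exact hwc.trans (h1 x ⟨hxw, hx⟩ hxc)
    · rintro ⟨h1, h2⟩
      exact ⟨⟨h2, h1 d hd hwd.symm⟩, (h1 c hc hcw).le⟩

/-! ### The successful coalition -/

/-- This is the margin of `d` among `t` candidates once `w` and `k + 1` others of `S` are gone. The
right side adds its sincere votes, its own coalition ballots and the inherited ones. Each departure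
raises the requirement by `U / (t + 1) ≤ U / 3` but yields about `U / 2`. -/
theorem average_lt {N U e k t : ℝ} (ht : 2 ≤ t) (hk : 0 ≤ k) (he : 0 < e) (hU : 100 * e ≤ U)
    (hN : N = (t + 1 + (k + 1)) * U) :
    N / t < N / (t * (t + 1)) - e + (U - e) + (k + 1) * (U / 2 - 2 * e) := by
  have h1 : N / t - N / (t * (t + 1)) = U + (k + 1) * (U / (t + 1)) := by
    have ht0 : t ≠ 0 := by linarith
    have ht1 : t + 1 ≠ 0 := by linarith
    rw [hN]
    field_simp
    ring
  have h2 : U / (t + 1) ≤ U / 3 := by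
    apply div_le_div_of_nonneg_left <;> linarith
  have h3 : (k + 1) * (U / (t + 1)) ≤ (k + 1) * (U / 3) := by gcongr
  have h4 : 0 ≤ k * (U / 6 - 2 * e) := mul_nonneg hk (by linarith)
  linarith

set_option maxHeartbeats 800000 in
/-- If `w` falls short of the average in `S`, then in a typical profile the voters who prefer some
other candidate `d` of `S` to `w` can make `d` win. -/
theorem exists_successful_coalition (hm : 2 ≤ m) (p : Profile m n) {S : Finset (Fin m)}
    {w : Fin m} (hw : w ∈ S) (hS : 2 ≤ S.card) (hlow : S.card * (score p S w + 1) ≤ n)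
    (hp : IsTypical p (1 / (100 * m))) :
    ∃ d, d ≠ w ∧ ∃ p' : Profile m n, (∀ r, p'.1 r < p.1 r → ¬ r w < r d) ∧
      ∀ τ : TieBreakingRule m n, irv hm τ p' = d := by
  have hne : (S.erase w).Nonempty := by
    rw [← Finset.card_pos, Finset.card_erase_of_mem hw]
    omega
  -- The favourite is the candidate to whom most ballots pass when `w` leaves `S`.
  obtain ⟨d, hdSw, hmax⟩ := (S.erase w).exists_max_image
    (fun c => votes p {r ∈ topRankings S w | r ∈ topRankings (S.erase w) c}) hne
  obtain ⟨hdw, hd⟩ := Finset.mem_erase.1 hdSw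
  have hwd := hdw.symm
  refine ⟨d, hdw, ?_⟩
  set s := S.card with hs
  set q := score p S w with hq
  set σ := sincereVotes p w d with hσ
  have hsm : s ≤ m := by simpa using S.card_le_univ
  have hmR : (2 : ℝ) ≤ m := by exact_mod_cast hm
  have hsR : (2 : ℝ) ≤ s := by exact_mod_cast hS
  have hnR : (0 : ℝ) < n := by
    have : 0 < n := lt_of_lt_of_le (by positivity) hlow
    exact_mod_cast this
  -- The error `e` is one percent of `n / m`, the smallest fair share in any set of candidates.
  set e : ℝ := 1 / (100 * m) * n with he
  have he0 : 0 < e := by positivity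
  have hle : ∀ t : ℕ, 0 < t → t ≤ m → 100 * e ≤ n / t := by
    intro t ht htm
    have : 100 * e = n / m := by rw [he]; field_simp
    rw [this]
    gcongr
  -- shares of the sincere voters
  have hσw : ∀ T, w ∈ T → d ∈ T → |(σ T w : ℝ) - n / T.card| ≤ e := by
    intro T hwT hdT
    rw [hσ, sincereVotes_self p hdT hwd, score_eq_votes]
    exact hp.abs_votes_sub_le (card_mul_card_topRankings hwT)
  have hσc : ∀ T, w ∈ T → d ∈ T → ∀ c ∈ T, c ≠ w → c ≠ d →
      |(σ T c : ℝ) - n / (2 * T.card)| ≤ e := by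
    intro T hwT hdT c hcT hcw hcd
    have := hp.abs_votes_sub_le
      (two_mul_card_mul_card_topRankings_prefers hcT hwT hdT hwd hcw hcd)
    push_cast at this
    exact this
  have hσd : ∀ T, w ∉ T → d ∈ T → |(σ T d : ℝ) - n / (T.card * (T.card + 1))| ≤ e := by
    intro T hwT hdT
    have := hp.abs_votes_sub_le (card_mul_succ_mul_card_topRankings_prefers hdT hwT)
    push_cast at this
    exact this
  -- the numbers of ballots
  set U : ℝ := n / s with hU
  have hUe : 100 * e ≤ U := hle s (by omega) hsm
  have hqU : U - e ≤ q := by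
    have := (abs_le.1 (hσw S hw hd)).1
    rw [hσ, sincereVotes_self p hd hwd] at this
    linarith
  set C := (S.erase w).erase d with hC
  have hmemC : ∀ {c}, c ∈ C ↔ c ≠ d ∧ c ≠ w ∧ c ∈ S := by
    intro c
    simp [hC]
  have hσC : ∀ c ∈ C, (σ S c : ℝ) ≤ U / 2 + e := by
    intro c hc
    obtain ⟨hcd, hcw, hcS⟩ := hmemC.1 hc
    have := (abs_le.1 (hσc S hw hd c hcS hcw hcd)).2
    have h2 : (n : ℝ) / (2 * S.card) = U / 2 := by rw [hU, div_div, mul_comm]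
    linarith
  -- This keeps the truncated subtraction `q + 1 - σ S c` exact.
  have hσq : ∀ c ∈ C, σ S c ≤ q + 1 := by
    intro c hc
    have h1 := hσC c hc
    have : (σ S c : ℝ) ≤ (q + 1 : ℕ) := by
      push_cast
      linarith
    exact_mod_cast this
  set V := votes p {r | r w < r d} with hV
  have hVsum : V = q + ∑ c ∈ C, σ S c := by
    rw [hV, ← sum_sincereVotes p w d ⟨w, hw⟩, ← Finset.add_sum_erase _ _ hw,
      ← Finset.add_sum_erase _ _ hdSw, sincereVotes_eq_zero p hw hwd, sincereVotes_self p hd hwd,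
      zero_add]
  have hCcard : C.card = s - 2 := by
    rw [hC, Finset.card_erase_of_mem hdSw, Finset.card_erase_of_mem hw]
    omega
  have hCsum : ∑ c ∈ C, (q + 1 - σ S c) + ∑ c ∈ C, σ S c = (s - 2) * (q + 1) := by
    rw [← Finset.sum_add_distrib, Finset.sum_congr rfl fun c hc => Nat.sub_add_cancel (hσq c hc),
      Finset.sum_const, hCcard, smul_eq_mul]
  -- The left side equals `s * (q + 1)`: the `q` votes of `w`, `q + 1` for each candidate of `C`,
  -- and `q + 2` for `d`. The surplus `B` also goes to `d`.
  have htotal : V + ∑ c ∈ C, (q + 1 - σ S c) + (q + 2) ≤ n := by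
    have : s * (q + 1) = (s - 2) * (q + 1) + 2 * (q + 1) := by
      rw [← add_mul, Nat.sub_add_cancel hS]
    omega
  obtain ⟨B, hB⟩ := Nat.exists_eq_add_of_le htotal
  set β : Fin m → ℕ := fun j => if j = d then q + 2 + B else if j ∈ C then q + 1 - σ S j else 0
    with hβ
  have hβd : β d = q + 2 + B := if_pos rfl
  have hβC : ∀ c ∈ C, β c = q + 1 - σ S c := by
    intro c hc
    simp only [hβ]
    rw [if_neg (hmemC.1 hc).1, if_pos hc]
  have hβ0 : ∀ c, c ≠ d → c ∉ C → β c = 0 := by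
    intro c hcd hc
    simp only [hβ]
    rw [if_neg hcd, if_neg hc]
  have hdC : d ∉ C := fun h => (hmemC.1 h).1 rfl
  have hβsum : V + ∑ j, β j = n := by
    rw [← Finset.sum_subset (Finset.subset_univ (insert d C)), Finset.sum_insert hdC, hβd,
      Finset.sum_congr rfl hβC, hB]
    · ring
    · intro c _ hc
      rw [Finset.mem_insert, not_or] at hc
      exact hβ0 c hc.1 hc.2
  have hβCR : ∀ c ∈ C, U / 2 - 2 * e ≤ β c := by
    intro c hc
    have h1 := hσC c hc
    rw [hβC c hc, Nat.cast_sub (hσq c hc)]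
    push_cast
    linarith
  obtain ⟨p', hp', hscore⟩ := exists_target_profile hm p w d β hβsum
  have hscore_ne : ∀ T, d ∈ T → ∀ c ∈ T, c ≠ d → score p' T c = σ T c + β c := by
    intro T hdT c hcT hcd
    rw [hscore T hdT c hcT, Finset.sum_eq_single_of_mem c (Finset.mem_univ c), if_pos]
    · rw [if_pos hcT]
    · intro j _ hjc
      apply if_neg
      split_ifs
      · exact hjc.symm
      · exact hcd
  have hscore_d : ∀ T, d ∈ T → ∀ J : Finset (Fin m), Disjoint J T →
      σ T d + β d + ∑ j ∈ J, β j ≤ score p' T d := by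
    intro T hdT J hJ
    have hdJ : d ∉ J := fun h => Finset.disjoint_left.1 hJ h hdT
    rw [hscore T hdT d hdT, add_assoc, ← Finset.sum_insert hdJ]
    apply Nat.add_le_add_left
    refine (Finset.sum_le_sum fun j hj => ?_).trans
      (Finset.sum_le_univ_sum_of_nonneg (s := insert d J) fun _ => Nat.zero_le _)
    rw [if_pos]
    rcases Finset.mem_insert.1 hj with rfl | hj
    · exact (if_pos hdT).symm
    · exact (if_neg (Finset.disjoint_left.1 hJ hj)).symm
  have hscore_d' : ∀ T, d ∈ T → σ T d + (q + 2) ≤ score p' T d := by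
    intro T hdT
    have := hscore_d T hdT ∅ (Finset.disjoint_empty_left _)
    rw [hβd, Finset.sum_empty] at this
    omega
  have hβw : β w = 0 := hβ0 w hwd fun h => (hmemC.1 h).2.1 rfl
  refine ⟨p', hp', fun τ => irv_eq_of_lowest hm τ p' hw hd hwd ?_ ?_ ?_⟩
  -- An outsider `a` has about half of `n / |T|`. In `S`, `w` keeps a full share, `d` has at least
  -- `q + 2` coalition ballots, and the others add about `U / 2` to a half share.
  · intro T hST c hc hcS
    obtain ⟨a, haT, haS⟩ := Finset.exists_of_ssubset hST
    have hdT := hST.1 hd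
    have hwT := hST.1 hw
    obtain ⟨hcT, hcmin⟩ := Finset.mem_filter.1 hc
    have hca := hcmin a haT
    have had : a ≠ d := fun h => haS (h ▸ hd)
    have haw : a ≠ w := fun h => haS (h ▸ hw)
    rw [hscore_ne T hdT a haT had, hβ0 a had fun h => haS (hmemC.1 h).2.2, add_zero] at hca
    have hca' : (score p' T c : ℝ) ≤ σ T a := by exact_mod_cast hca
    have ha := (abs_le.1 (hσc T hwT hdT a haT haw had)).2
    have ht0 : 0 < T.card := Finset.card_pos.2 ⟨d, hdT⟩
    have hte := hle T.card ht0 (by simpa using T.card_le_univ)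
    have hhalf : (n : ℝ) / (2 * T.card) = n / T.card / 2 := by rw [div_div, mul_comm]
    rw [hhalf] at ha
    by_cases hcd : c = d
    · subst hcd
      have h1 : ((q + 2 : ℕ) : ℝ) ≤ score p' T c := by
        exact_mod_cast le_trans (Nat.le_add_left _ _) (hscore_d' T hdT)
      push_cast at h1
      have hUT : (n : ℝ) / T.card ≤ U := by
        rw [hU]
        gcongr
        exact Finset.card_le_card hST.1
      linarith
    · rw [hscore_ne T hdT c hcT hcd] at hca'
      push_cast at hca'
      by_cases hcw : c = w
      · subst hcw
        have h1 := (abs_le.1 (hσw T hwT hdT)).1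
        rw [hβw, Nat.cast_zero] at hca'
        linarith
      · have h1 := (abs_le.1 (hσc T hwT hdT c hcT hcw hcd)).1
        rw [hhalf] at h1
        have h2 := hβCR c (hmemC.2 ⟨hcd, hcw, hcS⟩)
        linarith
  · intro c hc
    by_contra hcw
    obtain ⟨hcS, hcmin⟩ := Finset.mem_filter.1 hc
    have hcw' := hcmin w hw
    rw [hscore_ne S hd w hw hwd, hβw, hσ, sincereVotes_self p hd hwd] at hcw'
    by_cases hcd : c = d
    · subst hcd
      have := hscore_d' S hd
      omega
    · have hcC := hmemC.2 ⟨hcd, hcw, hcS⟩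
      rw [hscore_ne S hd c hcS hcd, hβC c hcC] at hcw'
      have := hσq c hcC
      omega
  · intro T hT hdT hTcard hlowest
    have hwT : w ∉ T := fun h => (Finset.mem_erase.1 (hT h)).1 rfl
    by_cases hTS : T = S.erase w
    -- Nobody in `C` has left yet, so exact counts decide: `d` has at least `q + 2` plus its
    -- transfer from `w`, while `c` has `q + 1` plus a transfer no larger. The strict inequality
    -- rules out a tie.
    · subst hTS
      obtain ⟨c, hcT, hcd⟩ := Finset.exists_mem_ne (by omega : 1 < (S.erase w).card) d
      obtain ⟨hcw, hcS⟩ := Finset.mem_erase.1 hcT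
      have hcC := hmemC.2 ⟨hcd, hcw, hcS⟩
      have h1 := (Finset.mem_filter.1 hlowest).2 c hcT
      have h2 := hscore_d' _ hdT
      rw [hscore_ne _ hdT c hcT hcd, hσ, sincereVotes_erase p hw hd hcS hcw hwd, hβC c hcC] at h1
      rw [hσ, sincereVotes_erase p hw hd hd hdw hwd, sincereVotes_eq_zero p hw hwd] at h2
      have h3 := hmax c hcT
      have h4 := hσq c hcC
      simp only [hσ] at h1 h4
      omega
    · have hss := hT.ssubset_of_ne hTS
      have hlt := Finset.card_lt_card hss
      rw [Finset.card_erase_of_mem hw] at hlt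
      -- At least one candidate of `C` is missing from `T`, and its ballots now count for `d`.
      obtain ⟨k, hk⟩ : ∃ k, s = T.card + 1 + (k + 1) := ⟨s - T.card - 2, by omega⟩
      have hJ : ((S.erase w) \ T).card = k + 1 := by
        rw [Finset.card_sdiff_of_subset hT, Finset.card_erase_of_mem hw]
        omega
      have h1 := hscore_d T hdT (S.erase w \ T) Finset.sdiff_disjoint
      have h2 : (k + 1 : ℕ) • (U / 2 - 2 * e) ≤ ∑ j ∈ (S.erase w) \ T, (β j : ℝ) := by
        rw [← hJ]
        refine Finset.card_nsmul_le_sum _ _ _ fun j hj => hβCR j ?_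
        obtain ⟨hj1, hj2⟩ := Finset.mem_sdiff.1 hj
        exact Finset.mem_erase.2 ⟨fun h => hj2 (h ▸ hdT), hj1⟩
      rw [hβd] at h1
      have h1' : (σ T d : ℝ) + (q + 2 + B) + ∑ j ∈ (S.erase w) \ T, (β j : ℝ)
          ≤ score p' T d := by exact_mod_cast h1
      have h3 := (abs_le.1 (hσd T hwT hdT)).1
      have h4 : (T.card : ℝ) * score p' T d ≤ n := by
        exact_mod_cast card_mul_score_le_of_mem_lowest hlowest
      have hT2 : (2 : ℝ) ≤ T.card := by exact_mod_cast hTcard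
      have hsk : (s : ℝ) = T.card + 1 + (k + 1) := by exact_mod_cast hk
      have hn : (n : ℝ) = (T.card + 1 + (k + 1)) * U := by
        rw [← hsk, hU, mul_div_cancel₀]
        linarith
      have h5 : (score p' T d : ℝ) ≤ n / T.card := by
        rw [le_div_iff₀ (by linarith)]
        linarith
      have h6 := average_lt hT2 (Nat.cast_nonneg (α := ℝ) k) he0 hUe hn
      have hB0 : (0 : ℝ) ≤ B := Nat.cast_nonneg _
      rw [nsmul_eq_mul] at h2
      push_cast at h2
      linarith

/-! ### Limit theorems on finite products -/

open ProbabilityTheory in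
-- The central limit theorem is applied to one infinite sequence, whose first `n` coordinates play
-- the voters.
theorem map_infinitePi_fin {α : Type*} [MeasurableSpace α] (μ : Measure α)
    [IsProbabilityMeasure μ] (n : ℕ) :
    (Measure.infinitePi fun _ : ℕ => μ).map (fun ω (i : Fin n) => ω i) =
      Measure.pi fun _ : Fin n => μ := by
  have h1 : iIndepFun (fun (i : ℕ) (ω : ℕ → α) => ω i) (Measure.infinitePi fun _ : ℕ => μ) :=
    iIndepFun_infinitePi (X := fun _ x => x) fun _ => measurable_id
  have h2 := iIndepFun.map_fun_eq_pi_map (f := fun (i : Fin n) (ω : ℕ → α) => ω i)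
    (fun i => (measurable_pi_apply (i : ℕ)).aemeasurable) (h1.precomp Fin.val_injective)
  rw [h2]
  congr 1
  ext1 i
  exact Measure.infinitePi_map_eval (fun _ : ℕ => μ) (i : ℕ)

open ProbabilityTheory in
/-- The sum of `n` independent copies of a non-degenerate random variable takes a value within
bounded distance of its mean with vanishing probability. -/
theorem tendsto_pi_sum_eq_zero {α : Type*} [MeasurableSpace α] (μ : Measure α)
    [IsProbabilityMeasure μ] {g : α → ℝ} (hg : Measurable g) (hg2 : MemLp g 2 μ)
    (hvar : Var[g; μ] ≠ 0) (a : ℕ → ℝ) {C : ℝ} (ha : ∀ n, |a n - n * μ[g]| ≤ C) :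
    Tendsto (fun n : ℕ => (Measure.pi fun _ : Fin n => μ) {x | ∑ v, g (x v) = a n})
      atTop (𝓝 0) := by
  set P := Measure.infinitePi fun _ : ℕ => μ with hP
  set X : ℕ → (ℕ → α) → ℝ := fun k ω => g (ω k) with hX
  have hmp : ∀ k, MeasurePreserving (fun ω : ℕ → α => ω k) P μ := fun k =>
    measurePreserving_eval_infinitePi (fun _ : ℕ => μ) k
  have hident : ∀ k, IdentDistrib (X k) g P μ := fun k =>
    ⟨by fun_prop, by fun_prop, by
      rw [← (hmp k).map_eq, Measure.map_map hg (hmp k).measurable]; rfl⟩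
  have hmean : P[X 0] = μ[g] := (hident 0).integral_eq
  have hvarX : Var[X 0; P] = Var[g; μ] := (hident 0).variance_eq
  set γ := gaussianReal 0 Var[X 0; P].toNNReal with hγ
  have hclt := tendstoInDistribution_inv_sqrt_mul_sum_sub (P := P) (X := X) (P' := γ) (Y := id)
    ⟨by fun_prop, Measure.map_id⟩ ((hident 0).memLp_iff.2 hg2)
    (iIndepFun_infinitePi (X := fun _ => g) fun _ => hg) fun k => (hident k).trans (hident 0).symm
  -- The limiting Gaussian is non-degenerate, so small balls around 0 have small mass; the
  -- portmanteau theorem carries this over to large `n`.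
  have hatom : γ {0} = 0 := by
    refine gaussianReal_absolutelyContinuous 0 ?_ (measure_singleton _)
    rw [hvarX, Ne, Real.toNNReal_eq_zero, not_le]
    exact lt_of_le_of_ne (variance_nonneg _ _) hvar.symm
  have hball : Tendsto (fun r => γ (Metric.cthickening r {0})) (𝓝 0) (𝓝 (γ {0})) :=
    tendsto_measure_cthickening_of_isCompact isCompact_singleton
  rw [hatom] at hball
  rw [ENNReal.tendsto_nhds_zero]
  intro δ hδ
  obtain ⟨r, hr0, hr⟩ : ∃ r : ℝ, 0 < r ∧ γ (Metric.cthickening r {0}) < δ := by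
    have h1 := (hball.mono_left nhdsWithin_le_nhds :
      Tendsto _ (𝓝[>] (0 : ℝ)) _).eventually_lt_const hδ
    obtain ⟨r, h2, h3⟩ := (h1.and self_mem_nhdsWithin).exists
    exact ⟨r, h3, h2⟩
  have hlim := (ProbabilityMeasure.limsup_measure_closed_le_of_tendsto hclt.tendsto
    (Metric.isClosed_cthickening (δ := r) (E := ({0} : Set ℝ)))).trans_lt
      (by simpa using hr)
  have hev := eventually_lt_of_limsup_lt hlim
  -- After normalisation the offset of `a n` from the mean is at most `C / √n`, eventually inside
  -- the ball.
  have hsqrt : Tendsto (fun n : ℕ => (√(n : ℝ))⁻¹ * C) atTop (𝓝 0) := by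
    rw [← zero_mul C]
    exact (tendsto_inv_atTop_zero.comp
      (Real.tendsto_sqrt_atTop.comp tendsto_natCast_atTop_atTop)).mul_const C
  filter_upwards [hev, hsqrt.eventually_lt_const hr0] with n hn hnr
  refine le_trans ?_ hn.le
  have hmeas : MeasurableSet {x : Fin n → α | ∑ v, g (x v) = a n} :=
    measurableSet_eq_fun (by fun_prop) measurable_const
  rw [← map_infinitePi_fin, Measure.map_apply (by fun_prop) hmeas]
  simp only [ProbabilityMeasure.coe_mk]
  rw [Measure.map_apply (by fun_prop) Metric.isClosed_cthickening.measurableSet]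
  refine measure_mono fun ω hω => ?_
  simp only [Set.mem_preimage, Set.mem_ofPred_eq] at hω ⊢
  rw [Metric.cthickening_singleton 0 hr0.le, Metric.mem_closedBall, dist_zero_right,
    Real.norm_eq_abs, hmean, Finset.sum_range, abs_mul, abs_of_nonneg (by positivity)]
  simp only [hX]
  rw [hω]
  exact (mul_le_mul_of_nonneg_left (ha n) (by positivity)).trans hnr.le

open ProbabilityTheory in
/-- The weak law of large numbers on finite products. -/
theorem tendsto_pi_abs_sum_sub_gt {α : Type*} [MeasurableSpace α] (μ : Measure α)
    [IsProbabilityMeasure μ] {g : α → ℝ} (hg2 : MemLp g 2 μ) {δ : ℝ}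
    (hδ : 0 < δ) :
    Tendsto (fun n : ℕ => (Measure.pi fun _ : Fin n => μ)
      {x | δ * n < |∑ v, g (x v) - n * μ[g]|}) atTop (𝓝 0) := by
  have hlim : Tendsto (fun n : ℕ => ENNReal.ofReal (Var[g; μ] / δ ^ 2 * (n : ℝ)⁻¹)) atTop
      (𝓝 0) := by
    rw [← ENNReal.ofReal_zero]
    apply ENNReal.tendsto_ofReal
    rw [← mul_zero (Var[g; μ] / δ ^ 2)]
    exact (tendsto_inv_atTop_zero.comp tendsto_natCast_atTop_atTop).const_mul _
  refine tendsto_of_tendsto_of_tendsto_of_le_of_le' tendsto_const_nhds hlim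
    (Eventually.of_forall fun _ => zero_le) ?_
  filter_upwards [eventually_gt_atTop 0] with n hn
  have hn' : (0 : ℝ) < n := by exact_mod_cast hn
  have hcoord : ∀ v : Fin n, MemLp (fun x : Fin n → α => g (x v)) 2 (Measure.pi fun _ => μ) :=
    fun v => hg2.comp_measurePreserving (measurePreserving_eval (fun _ : Fin n => μ) v)
  have hmem : MemLp (∑ v : Fin n, fun x : Fin n → α => g (x v)) 2 (Measure.pi fun _ => μ) :=
    memLp_finsetSum' _ fun v _ => hcoord v
  have hmean : ∫ x, (∑ v : Fin n, fun x : Fin n → α => g (x v)) x ∂(Measure.pi fun _ => μ)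
      = n * ∫ r, g r ∂μ := by
    simp only [Finset.sum_apply]
    rw [integral_finsetSum _ fun v _ => (hcoord v).integrable one_le_two]
    have : ∀ v : Fin n, ∫ x : Fin n → α, g (x v) ∂(Measure.pi fun _ => μ) = ∫ r, g r ∂μ := fun v =>
      integral_comp_eval (μ := fun _ : Fin n => μ) (i := v) hg2.aestronglyMeasurable
    simp [this]
  have hcheb := meas_ge_le_variance_div_sq hmem (c := δ * n) (by positivity)
  rw [variance_sum_pi fun _ => hg2, hmean] at hcheb
  refine (measure_mono ?_).trans (hcheb.trans (le_of_eq ?_))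
  · intro x hx
    simp only [Set.mem_ofPred_eq, Finset.sum_apply] at hx ⊢
    exact hx.le
  · congr 1
    simp only [Finset.sum_const, Finset.card_univ, Fintype.card_fin, nsmul_eq_mul]
    field_simp

/-! ### Impartial Culture -/

instance instDiscreteMeasurableSpaceRanking (m : ℕ) : DiscreteMeasurableSpace (Ranking m) :=
  ⟨fun _ => trivial⟩

/-- The uniform distribution on rankings. -/
noncomputable def uniformRanking (m : ℕ) : Measure (Ranking m) :=
  (PMF.uniformOfFintype (Ranking m)).toMeasure

instance instIsProbabilityMeasureUniformRanking (m : ℕ) :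
    IsProbabilityMeasure (uniformRanking m) :=
  inferInstanceAs (IsProbabilityMeasure (PMF.toMeasure _))

instance instIsProbabilityMeasureImpartialCulture (m n : ℕ) :
    IsProbabilityMeasure (impartialCulture m n) :=
  inferInstanceAs (IsProbabilityMeasure (Measure.pi fun _ : Fin n => uniformRanking m))

/-- The indicator function of a set of rankings. -/
def rankingIndicator (A : Finset (Ranking m)) (r : Ranking m) : ℝ := if r ∈ A then 1 else 0

theorem votes_profileOf (x : Fin n → Ranking m) (A : Finset (Ranking m)) :
    (votes (profileOf x) A : ℝ) = ∑ v, rankingIndicator A (x v) := by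
  have h : votes (profileOf x) A = (Finset.univ.filter fun v => x v ∈ A).card := by
    rw [Finset.card_eq_sum_card_fiberwise (t := A) (f := x) fun v hv => by simpa using hv]
    refine Finset.sum_congr rfl fun r hr => ?_
    rw [Finset.filter_filter]
    change (Finset.univ.filter fun v => x v = r).card = _
    congr 1
    ext v
    simp only [Finset.mem_filter, Finset.mem_univ, true_and]
    exact ⟨fun h => ⟨h ▸ hr, h⟩, fun h => h.2⟩
  rw [h]
  simp [rankingIndicator]

theorem integral_rankingIndicator (A : Finset (Ranking m)) :
    ∫ r, rankingIndicator A r ∂(uniformRanking m) = A.card / m.factorial := by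
  rw [uniformRanking, PMF.integral_eq_sum]
  simp [rankingIndicator, Fintype.card_perm, div_eq_mul_inv]

theorem memLp_rankingIndicator (A : Finset (Ranking m)) :
    MemLp (rankingIndicator A) 2 (uniformRanking m) :=
  MemLp.of_bound (Measurable.of_discrete).aestronglyMeasurable 1
    (Eventually.of_forall fun r => by
      rw [rankingIndicator]
      split_ifs <;> simp)

theorem tendsto_not_isTypical (m : ℕ) {δ : ℝ} (hδ : 0 < δ) :
    Tendsto (fun n => impartialCulture m n {x | ¬ IsTypical (profileOf x) δ}) atTop (𝓝 0) := by
  have h : Tendsto (fun n => ∑ A : Finset (Ranking m), impartialCulture m n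
      {x | δ * n < |(votes (profileOf x) A : ℝ) - n * (A.card / m.factorial)|}) atTop (𝓝 0) := by
    rw [← Finset.sum_const_zero (ι := Finset (Ranking m)) (s := Finset.univ)]
    refine tendsto_finsetSum _ fun A _ => ?_
    have := tendsto_pi_abs_sum_sub_gt (uniformRanking m) (memLp_rankingIndicator A) hδ
    rw [integral_rankingIndicator] at this
    simp_rw [votes_profileOf]
    exact this
  refine tendsto_of_tendsto_of_tendsto_of_le_of_le tendsto_const_nhds h
    (fun _ => zero_le) fun n => ?_
  refine (measure_mono fun x hx => ?_).trans (measure_iUnion_fintype_le _ _)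
  simp only [Set.mem_ofPred_eq, IsTypical, not_forall, not_le] at hx
  simpa using hx

/-- The division is that of natural numbers: the excluded value is the floor of the average, which
is within 1 of the mean score. -/
theorem tendsto_score_eq (S : Finset (Fin m)) (w : Fin m) (hw : w ∈ S) (hS : 2 ≤ S.card) :
    Tendsto (fun n => impartialCulture m n {x | score (profileOf x) S w = n / S.card}) atTop
      (𝓝 0) := by
  have hs0 : (0 : ℝ) < S.card := by exact_mod_cast (by omega : 0 < S.card)
  have hs2 : (2 : ℝ) ≤ S.card := by exact_mod_cast hS
  have hmean : ∫ r, rankingIndicator (topRankings S w) r ∂(uniformRanking m)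
      = 1 / (S.card : ℝ) := by
    have hfac : (0 : ℝ) < m.factorial := by exact_mod_cast m.factorial_pos
    have h : (S.card : ℝ) * (topRankings S w).card = m.factorial := by
      exact_mod_cast card_mul_card_topRankings hw
    rw [integral_rankingIndicator, div_eq_div_iff hfac.ne' hs0.ne', one_mul, ← h, mul_comm]
  have hvar : ProbabilityTheory.variance (rankingIndicator (topRankings S w))
      (uniformRanking m) ≠ 0 := by
    -- Zero variance would make an indicator equal to `1 / S.card`, strictly between 0 and 1.
    intro h0
    obtain ⟨r, hr⟩ := (ProbabilityTheory.ae_eq_integral_of_variance_eq_zero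
      (memLp_rankingIndicator _) h0).exists
    rw [hmean, rankingIndicator] at hr
    have h1 : (0 : ℝ) < 1 / S.card := one_div_pos.2 hs0
    have h2 : (1 : ℝ) / S.card < 1 := by
      rw [div_lt_one hs0]
      linarith
    split_ifs at hr <;> linarith
  have h := tendsto_pi_sum_eq_zero (uniformRanking m) Measurable.of_discrete
    (memLp_rankingIndicator (topRankings S w)) hvar
    (fun n => ((n / S.card : ℕ) : ℝ)) (C := 1) (fun n => by
      rw [hmean, mul_one_div, abs_le]
      constructor
      · have := Nat.lt_div_mul_add (a := n) (b := S.card) (by omega)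
        have h' : (n : ℝ) < (n / S.card : ℕ) * S.card + S.card := by exact_mod_cast this
        have : (n : ℝ) / S.card < (n / S.card : ℕ) + 1 := by
          rw [div_lt_iff₀ hs0]
          linarith
        linarith
      · have := Nat.cast_div_le (α := ℝ) (m := n) (n := S.card)
        linarith)
  convert h using 2 with n
  rw [impartialCulture]
  congr 1
  ext x
  simp only [Set.mem_ofPred_eq, score_eq_votes, ← votes_profileOf, Nat.cast_inj]

/-! ### Conclusion -/

theorem isManipulable_of_isTypical (hm : 2 ≤ m) (τ : TieBreakingRule m n) {p : Profile m n}
    (hp : IsTypical p (1 / (100 * m)))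
    (hne : ∀ (S : Finset (Fin m)) (w : Fin m), w ∈ S → 2 ≤ S.card → score p S w ≠ n / S.card)
    (hscw : ¬ ∃ c, IsSuperCondorcetWinner p c) : IsManipulable (irv hm τ) p := by
  rw [not_exists] at hscw
  have hw := hscw (irv hm τ p)
  simp only [IsSuperCondorcetWinner, not_forall, not_lt] at hw
  obtain ⟨S, hwS, hS, hle⟩ := hw
  have hs0 : 0 < S.card := by omega
  have hle' : score p S (irv hm τ p) ≤ n / S.card := by
    rw [Nat.le_div_iff_mul_le hs0]
    rw [le_div_iff₀ (by exact_mod_cast hs0)] at hle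
    exact_mod_cast hle
  have hlt := lt_of_le_of_ne hle' (hne S _ hwS hS)
  obtain ⟨d, hdw, p', hp', hirv⟩ := exists_successful_coalition hm p hwS hS
    ((Nat.mul_le_mul_left _ hlt).trans (Nat.mul_div_le _ _)) hp
  refine ⟨p', ?_, fun r hr => ?_⟩
  · rintro rfl
    exact hdw (hirv τ).symm
  · rw [hirv τ]
    refine lt_of_le_of_ne (not_lt.1 (hp' r hr)) fun h => hdw (r.injective h)

end Voting

/-- For every number `m ≥ 2` of candidates and every choice of tie-breaking rules (one for each
number of voters), the probability under Impartial Culture that IRV is immune to coalitional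
manipulation if and only if a Super Condorcet Winner exists tends to `1`. -/
theorem theorem2 (m : ℕ) (hm : 2 ≤ m) (τ : (n : ℕ) → Voting.TieBreakingRule m n) :
    Tendsto
      (fun n : ℕ => Voting.impartialCulture m n
        {x : Fin n → Voting.Ranking m |
          ¬ Voting.IsManipulable (Voting.irv hm (τ n)) (Voting.profileOf x) ↔
            ∃ c : Fin m, Voting.IsSuperCondorcetWinner (Voting.profileOf x) c})
      atTop (𝓝 1) := by
  open Voting in
  have hδ : (0 : ℝ) < 1 / (100 * m) := by
    have : (0 : ℝ) < m := by exact_mod_cast (by omega : 0 < m)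
    positivity
  let ι := {q : Finset (Fin m) × Fin m // q.2 ∈ q.1 ∧ 2 ≤ q.1.card}
  have hties : Tendsto (fun n => ∑ q : ι, impartialCulture m n
      {x | score (profileOf x) q.1.1 q.1.2 = n / q.1.1.card}) atTop (𝓝 0) := by
    rw [← Finset.sum_const_zero (ι := ι) (s := Finset.univ)]
    exact tendsto_finsetSum _ fun q _ => tendsto_score_eq q.1.1 q.1.2 q.2.1 q.2.2
  have hbad := (tendsto_not_isTypical m hδ).add hties
  rw [add_zero] at hbad
  have hgood := ENNReal.Tendsto.sub (tendsto_const_nhds (x := (1 : ENNReal))) hbad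
    (Or.inl ENNReal.one_ne_top)
  rw [tsub_zero] at hgood
  refine tendsto_of_tendsto_of_tendsto_of_le_of_le hgood tendsto_const_nhds (fun n => ?_)
    fun n => prob_le_one
  rw [tsub_le_iff_right, ← measure_univ (μ := impartialCulture m n)]
  -- The equivalence, atypicality and the exceptional scores cover all outcomes; this needs no
  -- measurability.
  refine le_trans (measure_mono fun x _ => ?_) ((measure_union_le _ _).trans (add_le_add_right
    ((measure_union_le _ _).trans (add_le_add_right (measure_iUnion_fintype_le _ _) _)) _))
  by_contra hx
  simp only [Set.mem_union, Set.mem_iUnion, Set.mem_ofPred_eq, not_or, not_exists, not_not] at hx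
  obtain ⟨hiff, htyp, hne⟩ := hx
  refine hiff ⟨fun himm => ?_, fun ⟨c, hc⟩ => hc.not_isManipulable hm (τ n)⟩
  by_contra hscw
  exact himm (isManipulable_of_isTypical hm (τ n) htyp
    (fun S w hw hS => hne ⟨(S, w), hw, hS⟩) hscw)
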